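/- A garden-hose protocol with $s\ge 0$ pipes for two players with input sets $X$ and $Y$ has a set $V$ of $s$ vertices (the pipes) and one extra vertex $t$ (the tap). It assigns to each $x\in X$ (Alice's input) a matching $E_A(x)$ among $V\cup\{t\}$ and to each $y\in Y$ (Bob's input) a matching $E_B(y)$ among $V$; matchings need not be perfect. In the graph $(V\cup\{t\},E_A(x)\cup E_B(y))$ there is a unique maximal path starting at $t$. The protocol computes $f:X\times Y\to\{0,1\}$ if for all $(x,y)$ this path has even length if and only if $f(x,y)=0$. The garden-hose complexity $GH(f)$ is the smallest $s$ for which a protocol with $s$ pipes computes $f$ ($\infty$ if there is none). For bits $b_1,\dots,b_k$ let $MAJ(b_1,\dots,b_k)=1$ if and only if $\sum_i b_i\ge k/2$. Theorem. There is an absolute constant $C$ such that for all sets $X,Y$, all $k\ge 1$ and all functions $f_1,\dots,f_k:X\times Y\to\{0,1\}$: 1. $GH\left(\bigvee_{i} f_i\right)\le C\sum_{i=1}^k GH(f_i)$; 2. $GH\left(\bigwedge_{i} f_i\right)\le C\sum_{i=1}^k GH(f_i)$; 3. $GH\left(\bigoplus_{i} f_i\right)\le C\sum_{i=1}^k GH(f_i)$;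 4. if $k\ge 2$, then $GH\left(MAJ(f_1,\dots,f_k)\right)\le C\left(\sum_{i=1}^k GH(f_i)\right)\log^3 k$. Here the connectives are applied pointwise, i.e. $(f_1,\dots,f_k)$ is evaluated at the same $(x,y)\in X\times Y$. -/

import Mathlib

open scoped ENNReal

universe u v

namespace GardenHose

/-- The edges of `E` form a matching: every vertex is joined to at most one other vertex. -/
def IsMatching {V : Type*} (E : SimpleGraph V) : Prop :=
  ∀ ⦃a b c : V⦄, E.Adj a b → E.Adj a c → b = c

/-- A garden-hose protocol with `s` pipes. The pipes are the vertices `some i` with `i : Fin s`, and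
`none` is the tap. Alice's input determines a matching among the pipes and the tap, Bob's input
determines a matching among the pipes. -/
structure Protocol (X : Type u) (Y : Type v) (s : ℕ) where
  alice : X → SimpleGraph (Option (Fin s))
  bob : Y → SimpleGraph (Fin s)
  alice_isMatching : ∀ x, IsMatching (alice x)
  bob_isMatching : ∀ y, IsMatching (bob y)

variable {X : Type u} {Y : Type v} {s : ℕ}

/-- The graph on the pipes and the tap whose edges are those of Alice and those of Bob. -/
def Protocol.graph (P : Protocol X Y s) (x : X) (y : Y) : SimpleGraph (Option (Fin s)) :=
  P.alice x ⊔ (P.bob y).map Function.Embedding.some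

/-- On input `(x, y)` the path that starts at the tap and cannot be continued has length `n`.
All degrees are at most two and the tap has degree at most one, so there is exactly one such `n`. -/
def Protocol.PathLength (P : Protocol X Y s) (x : X) (y : Y) (n : ℕ) : Prop :=
  ∃ (w : Option (Fin s)) (p : (P.graph x y).Walk none w),
    p.IsPath ∧ (∀ z, (P.graph x y).Adj w z → z ∈ p.support) ∧ p.length = n

/-- The protocol computes `f`: on every input the path from the tap has even length if and only if
the value of `f` is `0`. -/
def Protocol.Computes (P : Protocol X Y s) (f : X → Y → Bool) : Prop :=
  ∀ x y, ∃ n, P.PathLength x y n ∧ (Even n ↔ f x y = false)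

/-- The garden-hose complexity of `f`: the least number of pipes of a protocol that computes `f`
(`⊤` if there is no such protocol). -/
noncomputable def GH (f : X → Y → Bool) : ℕ∞ :=
  ⨅ (s : ℕ) (_ : ∃ P : Protocol X Y s, P.Computes f), (s : ℕ∞)

/-- The number of ones in a tuple of bits. -/
def ones {k : ℕ} (b : Fin k → Bool) : ℕ := ∑ i, (b i).toNat

/-- Disjunction of `k` bits. -/
def OR {k : ℕ} (b : Fin k → Bool) : Bool := decide (∃ i, b i = true)

/-- Conjunction of `k` bits. -/
def AND {k : ℕ} (b : Fin k → Bool) : Bool := decide (∀ i, b i = true)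

/-- Parity of `k` bits. -/
def XOR {k : ℕ} (b : Fin k → Bool) : Bool := decide (Odd (ones b))

/-- Majority of `k` bits: at least `k / 2` of them are one. -/
def MAJ {k : ℕ} (b : Fin k → Bool) : Bool := decide (k ≤ 2 * ones b)

/-- The composition `g (f₁, …, f_k)` as a function of the inputs of the two players. -/
def comp {k : ℕ} (g : (Fin k → Bool) → Bool) (f : Fin k → X → Y → Bool) : X → Y → Bool :=
  fun x y => g (fun i => f i x y)

end GardenHose

/-! A component of a union of two matchings is a path or a cycle, so the run of a protocol can be
followed by reachability alone. The position where it ends depends on the input. Gluing copies of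
the protocol together at the vertices where it may end makes the water run back to the tap of a
second copy, and which copy this is reveals the value (`Protocol.joins_switch`). Such switches route
a finite set of states through an injection that depends on `f i` (`HasSwitch.realizes`). Injections
compose with additive cost (`Realizes.comp`), and they can be undone: once a state has been
inspected, a reversed copy leads back to the known initial state, from which the computation goes on
(`Decides.step`). Disjunction and conjunction are decision lists of this kind, and parity is a sum
over `ZMod 2`.

For majority, exact counting modulo a number of order `k` would cost a factor of order `k`. Instead
a circle is rotated by a small angle for every function equal to one. With `D = (2 * n + 1) *
n.centralBinom` and `n` of order `log k`, the angle `2 ^ j / D` is an integer combination of the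
fractions `1 / (n + 1), …, 1 / (2 * n + 1)` (`sum_numerator_div`). So it is a sequence of rotations
of cycles with only O(`n`) points, up to a small rounding error (`exists_realizes_rotations`). The
final position gives the sign of `2 ^ j / D * (count - T)`, or shows that this number is at most 1/8
in absolute value, and then the scale can be doubled (`verdict_cases`). There are `4 * n` scales
with `n + 1` cycles of O(`n`) points each, whence the factor `log ^ 3 k`. -/

namespace GardenHose

open SimpleGraph

/-! ### Matchings -/

section Matchings

variable {V W ι : Type*}

theorem IsMatching.map {E : SimpleGraph V} (h : IsMatching E) {f : V → W}
    (hf : Function.Injective f) : IsMatching (E.map f) := by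
  rintro _ _ _ ⟨-, a, b, hab, rfl, rfl⟩ ⟨-, a', c, hac, h', rfl⟩
  obtain rfl := hf h'
  rw [h hab hac]

theorem IsMatching.comap {E : SimpleGraph W} (h : IsMatching E) {f : V → W}
    (hf : Function.Injective f) : IsMatching (E.comap f) :=
  fun _ _ _ hab hac => hf (h hab hac)

theorem IsMatching.sup {E F : SimpleGraph V} (hE : IsMatching E) (hF : IsMatching F)
    (h : ∀ a b c, E.Adj a b → ¬ F.Adj a c) : IsMatching (E ⊔ F) := by
  rintro a b c (hab | hab) (hac | hac)
  · exact hE hab hac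
  · exact (h _ _ _ hab hac).elim
  · exact (h _ _ _ hac hab).elim
  · exact hF hab hac

theorem IsMatching.sum {E : SimpleGraph V} {F : SimpleGraph W} (hE : IsMatching E)
    (hF : IsMatching F) : IsMatching (E ⊕g F) := by
  rintro (a | a) (b | b) (c | c) hab hac <;> simp_all
  · exact hE hab hac
  · exact hF hab hac

theorem isMatching_bot : IsMatching (⊥ : SimpleGraph V) := fun _ _ _ h => h.elim

/-- A partial injection whose domain and range are disjoint is a matching. -/
theorem isMatching_fromRel {r : V → V → Prop} (h₁ : ∀ a b c, r a b → r a c → b = c)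
    (h₂ : ∀ a b c, r a c → r b c → a = b) (h₃ : ∀ a b c, r a b → ¬ r b c) :
    IsMatching (fromRel r) := by
  rintro a b c ⟨-, hab | hab⟩ ⟨-, hac | hac⟩
  · exact h₁ _ _ _ hab hac
  · exact (h₃ _ _ _ hac hab).elim
  · exact (h₃ _ _ _ hab hac).elim
  · exact h₂ _ _ _ hab hac

theorem fromRel_adj_of_rel {r : V → V → Prop} (h₃ : ∀ a b c, r a b → ¬ r b c) {a b : V}
    (h : r a b) : (fromRel r).Adj a b :=
  ⟨fun e => h₃ a a b (by rw [← e] at h; exact h) h, Or.inl h⟩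

/-- Disjoint copies of a graph. -/
def copies (ι : Type*) (E : SimpleGraph V) : SimpleGraph (ι × V) where
  Adj a b := a.1 = b.1 ∧ E.Adj a.2 b.2
  symm := ⟨fun _ _ h => ⟨h.1.symm, h.2.symm⟩⟩
  loopless := ⟨fun _ h => E.loopless.irrefl _ h.2⟩

theorem IsMatching.copies {E : SimpleGraph V} (h : IsMatching E) :
    IsMatching (copies ι E) :=
  fun _ _ _ hab hac => Prod.ext (hab.1.symm.trans hac.1) (h hab.2 hac.2)

theorem copies_reachable {E : SimpleGraph V} (i : ι) {a b : V} (h : E.Reachable a b) :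
    (copies ι E).Reachable (i, a) (i, b) :=
  h.map (⟨fun v => (i, v), fun h => ⟨rfl, h⟩⟩ : E →g copies ι E)

end Matchings

/-! ### Gadgets -/

/-- A graph made of a matching of Alice and a matching of Bob, with ports at which further edges of
Bob may be attached. -/
structure Gadget (X : Type u) (Y : Type v) (P : Type) where
  V : Type
  [fintype : Fintype V]
  alice : X → SimpleGraph V
  bob : Y → SimpleGraph V
  alice_isMatching : ∀ x, IsMatching (alice x)
  bob_isMatching : ∀ y, IsMatching (bob y)
  port : P → V
  port_injective : Function.Injective port
  bob_free : ∀ y p w, ¬ (bob y).Adj (port p) w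

attribute [instance] Gadget.fintype

namespace Gadget

variable {X : Type u} {Y : Type v} {P P' : Type}

/-- The union of the two matchings. -/
def graph (G : Gadget X Y P) (x : X) (y : Y) : SimpleGraph G.V := G.alice x ⊔ G.bob y

/-- The number of vertices. -/
def size (G : Gadget X Y P) : ℕ := Fintype.card G.V

/-- On input `(x, y)` two ports lie in the same component. -/
def Joins (G : Gadget X Y P) (x : X) (y : Y) (p q : P) : Prop :=
  (G.graph x y).Reachable (G.port p) (G.port q)

theorem Joins.symm {G : Gadget X Y P} {x : X} {y : Y} {p q : P} (h : G.Joins x y p q) :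
    G.Joins x y q p :=
  SimpleGraph.Reachable.symm h

/-- Disjoint copies of a gadget. -/
def replicate (G : Gadget X Y P) (ι : Type) [Fintype ι] : Gadget X Y (ι × P) where
  V := ι × G.V
  alice x := copies ι (G.alice x)
  bob y := copies ι (G.bob y)
  alice_isMatching x := (G.alice_isMatching x).copies
  bob_isMatching y := (G.bob_isMatching y).copies
  port p := (p.1, G.port p.2)
  port_injective p q h := by
    simp only [Prod.mk.injEq] at h
    exact Prod.ext h.1 (G.port_injective h.2)
  bob_free y p w h := G.bob_free y p.2 w.2 h.2

theorem size_replicate (G : Gadget X Y P) (ι : Type) [Fintype ι] :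
    (G.replicate ι).size = Fintype.card ι * G.size :=
  Fintype.card_prod _ _

theorem joins_replicate {G : Gadget X Y P} {ι : Type} [Fintype ι] {x : X} {y : Y} (i : ι) {p q : P}
    (h : G.Joins x y p q) : (G.replicate ι).Joins x y (i, p) (i, q) := by
  refine (copies_reachable i h).mono ?_
  rintro a b ⟨h₁, h₂ | h₂⟩
  · exact Or.inl ⟨h₁, h₂⟩
  · exact Or.inr ⟨h₁, h₂⟩

/-- The disjoint union of two gadgets. -/
def sum (G : Gadget X Y P) (H : Gadget X Y P') : Gadget X Y (P ⊕ P') where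
  V := G.V ⊕ H.V
  alice x := G.alice x ⊕g H.alice x
  bob y := G.bob y ⊕g H.bob y
  alice_isMatching x := (G.alice_isMatching x).sum (H.alice_isMatching x)
  bob_isMatching y := (G.bob_isMatching y).sum (H.bob_isMatching y)
  port := Sum.map G.port H.port
  port_injective := Sum.map_injective.2 ⟨G.port_injective, H.port_injective⟩
  bob_free y p w := by
    rcases p with p | p <;> rcases w with w | w <;> simp [G.bob_free, H.bob_free]

theorem size_sum (G : Gadget X Y P) (H : Gadget X Y P') : (G.sum H).size = G.size + H.size :=
  Fintype.card_sum

theorem joins_sum_inl {G : Gadget X Y P} (H : Gadget X Y P') {x : X} {y : Y} {p q : P}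
    (h : G.Joins x y p q) : (G.sum H).Joins x y (Sum.inl p) (Sum.inl q) :=
  SimpleGraph.Reachable.map (G' := (G.sum H).graph x y)
    (⟨Sum.inl, fun h => h.imp id id⟩ : G.graph x y →g (G.sum H).graph x y) h

theorem joins_sum_inr (G : Gadget X Y P) {H : Gadget X Y P'} {x : X} {y : Y} {p q : P'}
    (h : H.Joins x y p q) : (G.sum H).Joins x y (Sum.inr p) (Sum.inr q) :=
  SimpleGraph.Reachable.map (G' := (G.sum H).graph x y)
    (⟨Sum.inr, fun h => h.imp id id⟩ : H.graph x y →g (G.sum H).graph x y) h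

/-- The gadget in which Bob joins some ports by a constant matching. -/
def wire (G : Gadget X Y P) (W : SimpleGraph P) (hW : IsMatching W) (e : P' → P)
    (he : Function.Injective e) (hf : ∀ p q, ¬ W.Adj (e p) q) : Gadget X Y P' where
  V := G.V
  alice := G.alice
  bob y := G.bob y ⊔ W.map G.port
  alice_isMatching := G.alice_isMatching
  bob_isMatching y := by
    refine (G.bob_isMatching y).sup (hW.map G.port_injective) ?_
    rintro _ b _ h ⟨-, p, q, -, rfl, rfl⟩
    exact G.bob_free y p b h
  port := G.port ∘ e
  port_injective := G.port_injective.comp he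
  bob_free y p w h := by
    rcases h with h | ⟨-, q, r, h, hq, -⟩
    · exact G.bob_free y _ w h
    · obtain rfl := G.port_injective hq
      exact hf p r h

section Wire

variable {G : Gadget X Y P} {W : SimpleGraph P} {hW : IsMatching W} {e : P' → P}
  {he : Function.Injective e} {hf : ∀ p q, ¬ W.Adj (e p) q} {x : X} {y : Y}

/-- Two ports of a gadget are joined after the wiring. -/
def WireJoins (G : Gadget X Y P) (W : SimpleGraph P) (x : X) (y : Y) (p q : P) : Prop :=
  Relation.ReflTransGen (fun p q => G.Joins x y p q ∨ W.Adj p q) p q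

theorem joins_wire {p q : P'} (h : WireJoins G W x y (e p) (e q)) :
    (G.wire W hW e he hf).Joins x y p q := by
  have key : ∀ a b : P, WireJoins G W x y a b →
      ((G.wire W hW e he hf).graph x y).Reachable (G.port a) (G.port b) := by
    intro a b h
    induction h with
    | refl => exact SimpleGraph.Reachable.refl _
    | tail _ hbc ih =>
      refine SimpleGraph.Reachable.trans ih ?_
      rcases hbc with hbc | hbc
      · exact SimpleGraph.Reachable.mono (G := G.graph x y) (sup_le_sup_left le_sup_left _) hbc
      · exact SimpleGraph.Adj.reachable (Or.inr (Or.inr ⟨fun h => hbc.ne (G.port_injective h), _, _, hbc, rfl, rfl⟩))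
  exact key _ _ h

theorem WireJoins.of_joins {p q : P} (h : G.Joins x y p q) : WireJoins G W x y p q :=
  Relation.ReflTransGen.single (Or.inl h)

theorem WireJoins.of_adj {p q : P} (h : W.Adj p q) : WireJoins G W x y p q :=
  Relation.ReflTransGen.single (Or.inr h)

theorem WireJoins.trans {p q r : P} (h : WireJoins G W x y p q) (h' : WireJoins G W x y q r) :
    WireJoins G W x y p r :=
  Relation.ReflTransGen.trans h h'

end Wire

end Gadget

/-! ### Alternating paths -/

section Alternating

variable {Ω : Type*} {A B : SimpleGraph Ω} {t w : Ω}

/-- The tap has no edge of Bob, so the first edge is Alice's. Two consecutive edges from one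
matching would return to the same vertex. -/
theorem alternating_of_isPath (hA : IsMatching A) (hB : IsMatching B) (ht : ∀ z, ¬ B.Adj t z)
    {p : (A ⊔ B).Walk t w} (hp : p.IsPath) {i : ℕ} (hi : i < p.length) :
    (Even i → A.Adj (p.getVert i) (p.getVert (i + 1))) ∧
      (¬ Even i → B.Adj (p.getVert i) (p.getVert (i + 1))) := by
  induction i with
  | zero =>
    refine ⟨fun _ => ?_, fun h => (h Even.zero).elim⟩
    refine (p.adj_getVert_succ hi).resolve_right fun h => ?_
    rw [p.getVert_zero] at h
    exact ht _ h
  | succ i ih =>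
    obtain ⟨ih₁, ih₂⟩ := ih (by omega)
    have hne : p.getVert i ≠ p.getVert (i + 1 + 1) := fun h => by
      have := hp.getVert_injOn (by simp; omega) (by simp; omega) h
      omega
    have hadj := p.adj_getVert_succ hi
    refine ⟨fun h => ?_, fun h => ?_⟩
    · rw [Nat.even_add_one] at h
      exact hadj.resolve_right fun h' => hne (hB (ih₂ h).symm h')
    · rw [Nat.even_add_one, not_not] at h
      exact hadj.resolve_left fun h' => hne (hA (ih₁ h).symm h')

/-- A further edge at the end would lead to an earlier vertex of the path. By alternation the
partner of that vertex in the same matching is already one of its neighbours on the path, and it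
differs from the end. -/
theorem free_end_of_isPath (hA : IsMatching A) (hB : IsMatching B) (ht : ∀ z, ¬ B.Adj t z)
    {p : (A ⊔ B).Walk t w} (hp : p.IsPath) (hmax : ∀ z, (A ⊔ B).Adj w z → z ∈ p.support) :
    (Even p.length → ∀ z, ¬ A.Adj w z) ∧ (¬ Even p.length → ∀ z, ¬ B.Adj w z) := by
  have key : ∀ i j, i ≤ p.length → j < p.length → p.getVert j ≠ w := fun i j _ hj h => by
    have := hp.getVert_injOn (by simp; omega) (by simp) (h.trans p.getVert_length.symm)
    omega
  have hlt : ∀ z i, (A ⊔ B).Adj w z → p.getVert i = z → i ≤ p.length → i < p.length := by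
    intro z i h hi hi'
    refine lt_of_le_of_ne hi' fun e => ?_
    rw [e, p.getVert_length] at hi
    exact h.ne hi
  refine ⟨fun hn z hz => ?_, fun hn z hz => ?_⟩
  · obtain ⟨i, hi, hi'⟩ := Walk.mem_support_iff_exists_getVert.1 (hmax z (Or.inl hz))
    have hi'' := hlt z i (Or.inl hz) hi hi'
    subst hi
    rcases Nat.even_or_odd i with he | ⟨m, rfl⟩
    · have hlt : i + 1 < p.length := by
        refine lt_of_le_of_ne hi'' fun e => ?_
        rw [← e] at hn
        exact (Nat.even_add_one.1 hn) he
      exact key 0 _ (Nat.zero_le _) hlt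
        (hA ((alternating_of_isPath hA hB ht hp hi'').1 he) hz.symm)
    · have h := (alternating_of_isPath hA hB ht hp (i := 2 * m) (by omega)).1 (by simp)
      exact key 0 (2 * m) (Nat.zero_le _) (by omega) (hA h.symm hz.symm)
  · obtain ⟨i, hi, hi'⟩ := Walk.mem_support_iff_exists_getVert.1 (hmax z (Or.inr hz))
    have hi'' := hlt z i (Or.inr hz) hi hi'
    subst hi
    rcases Nat.even_or_odd' i with ⟨m, rfl | rfl⟩
    · rcases m with _ | m
      · simp only [mul_zero, Walk.getVert_zero] at hz
        exact ht _ hz.symm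
      · have h := (alternating_of_isPath hA hB ht hp (i := 2 * m + 1) (by omega)).2 (by simp)
        exact key 0 (2 * m + 1) (Nat.zero_le _) (by omega) (hB h.symm hz.symm)
    · have hlt : 2 * m + 1 + 1 < p.length := by
        refine lt_of_le_of_ne hi'' fun e => ?_
        rw [← e] at hn
        exact hn ⟨m + 1, by ring⟩
      exact key 0 _ (Nat.zero_le _) hlt
        (hB ((alternating_of_isPath hA hB ht hp hi'').2 (by simp)) hz.symm)

/-- Conversely, a dead end reached from the tap is the end of the run. The last edge belongs to the
player whose matching still covers that vertex, which fixes the parity. -/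
theorem isPath_of_free_end (hA : IsMatching A) (hB : IsMatching B) (ht : ∀ z, ¬ B.Adj t z)
    (hw : w ≠ t) {p : (A ⊔ B).Walk t w} (hp : p.IsPath) :
    ((∀ z, ¬ A.Adj w z) → (∀ z, (A ⊔ B).Adj w z → z ∈ p.support) ∧ Even p.length) ∧
      ((∀ z, ¬ B.Adj w z) → (∀ z, (A ⊔ B).Adj w z → z ∈ p.support) ∧ ¬ Even p.length) := by
  obtain ⟨n, hn⟩ : ∃ n, p.length = n + 1 := by
    refine Nat.exists_eq_succ_of_ne_zero fun h => hw ?_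
    rw [← p.getVert_length, h, p.getVert_zero]
  have hlast : p.getVert (n + 1) = w := by rw [← hn, p.getVert_length]
  obtain ⟨h₁, h₂⟩ := alternating_of_isPath hA hB ht hp (i := n) (by omega)
  rw [hlast] at h₁ h₂
  rw [hn, Nat.even_add_one]
  refine ⟨fun hf => ?_, fun hf => ?_⟩
  · have he : ¬ Even n := fun he => hf _ (h₁ he).symm
    refine ⟨fun z hz => ?_, he⟩
    rw [hB (hz.resolve_left (hf z)) (h₂ he).symm]
    exact p.getVert_mem_support n
  · have he : Even n := not_not.1 fun he => hf _ (h₂ he).symm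
    refine ⟨fun z hz => ?_, not_not.2 he⟩
    rw [hA (hz.resolve_right (hf z)) (h₁ he).symm]
    exact p.getVert_mem_support n

end Alternating

variable {X : Type u} {Y : Type v} {s : ℕ}

theorem Protocol.bob_map_isMatching (P : Protocol X Y s) (y : Y) :
    IsMatching ((P.bob y).map Function.Embedding.some) :=
  (P.bob_isMatching y).map Function.Embedding.some.injective

theorem map_some_not_adj_none {α : Type*} (E : SimpleGraph α) (z : Option α) :
    ¬ (E.map Function.Embedding.some).Adj none z := by
  rintro ⟨-, a, b, -, h, -⟩
  exact Option.some_ne_none a h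

/-! ### The switch of a protocol -/

/-- Three copies of a graph, where the vertices from `U` of the copies `0` and `j` are joined. -/
def fold {Ω : Type*} (E : SimpleGraph Ω) (U : Set Ω) (j : Fin 3) : SimpleGraph (Fin 3 × Ω) :=
  copies (Fin 3) E ⊔ fromRel fun a b => a.1 = 0 ∧ b.1 = j ∧ a.2 = b.2 ∧ a.2 ∈ U

section Fold

variable {Ω : Type*} {E : SimpleGraph Ω} {U : Set Ω} {j : Fin 3}

theorem fold_isMatching (hE : IsMatching E) (hU : ∀ a ∈ U, ∀ z, ¬ E.Adj a z) (hj : j ≠ 0) :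
    IsMatching (fold E U j) := by
  refine hE.copies.sup (isMatching_fromRel ?_ ?_ ?_) ?_
  · rintro a b c ⟨-, h₁, h₂, -⟩ ⟨-, h₃, h₄, -⟩
    exact Prod.ext (h₁.trans h₃.symm) (h₂.symm.trans h₄)
  · rintro a b c ⟨h₁, -, h₂, -⟩ ⟨h₃, -, h₄, -⟩
    exact Prod.ext (h₁.trans h₃.symm) (h₂.trans h₄.symm)
  · rintro a b c ⟨-, h₁, -⟩ ⟨h₂, -⟩
    exact hj (h₁.symm.trans h₂)
  · rintro a b c ⟨-, hab⟩ ⟨-, ⟨-, -, -, h⟩ | ⟨-, -, h₁, h₂⟩⟩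
    · exact hU _ h _ hab
    · rw [h₁] at h₂
      exact hU _ h₂ _ hab

theorem fold_not_adj {a : Fin 3 × Ω} (h₁ : ∀ z, ¬ E.Adj a.2 z) (h₂ : a.2 ∉ U) (b : Fin 3 × Ω) :
    ¬ (fold E U j).Adj a b := by
  rintro (⟨-, h⟩ | ⟨-, ⟨-, -, -, h⟩ | ⟨-, -, h, h'⟩⟩)
  · exact h₁ _ h
  · exact h₂ h
  · rw [h] at h'
    exact h₂ h'

theorem fold_adj (hj : j ≠ 0) {a : Ω} (ha : a ∈ U) : (fold E U j).Adj (0, a) (j, a) :=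
  Or.inr ⟨fun h => hj (Prod.ext_iff.1 h).1.symm, Or.inl ⟨rfl, rfl, rfl, ha⟩⟩

end Fold

/-- A gadget that joins its port `0` to port `1` if the protocol ends on Alice's side, and to
port `2` if it ends on Bob's side. -/
def Protocol.switch (P : Protocol X Y s) : Gadget X Y (Fin 3) where
  V := Fin 3 × Option (Fin s)
  alice x := fold (P.alice x) {a | ∀ z, ¬ (P.alice x).Adj a z} 1
  bob y := fold ((P.bob y).map Function.Embedding.some)
    {a | a ≠ none ∧ ∀ z, ¬ ((P.bob y).map Function.Embedding.some).Adj a z} 2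
  alice_isMatching x := fold_isMatching (P.alice_isMatching x) (fun _ h => h) (by decide)
  bob_isMatching y := fold_isMatching (P.bob_map_isMatching y) (fun _ h => h.2) (by decide)
  port i := (i, none)
  port_injective _ _ h := (Prod.ext_iff.1 h).1
  bob_free y _ b := fold_not_adj (map_some_not_adj_none _) (fun h => h.1 rfl) b

theorem Protocol.switch_reachable (P : Protocol X Y s) {x : X} {y : Y} {a b : Option (Fin s)}
    (i : Fin 3) (h : (P.graph x y).Reachable a b) :
    (P.switch.graph x y).Reachable (i, a) (i, b) := by
  refine (copies_reachable i h).mono ?_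
  rintro a b ⟨h₁, h₂ | h₂⟩
  · exact Or.inl (Or.inl ⟨h₁, h₂⟩)
  · exact Or.inr (Or.inl ⟨h₁, h₂⟩)

/-- The run in copy `0` ends at a vertex left free by Alice (value 0) or by Bob (value 1). There it
crosses to copy `1` or `2` and retraces the same path to the tap of that copy. -/
theorem Protocol.joins_switch {P : Protocol X Y s} {f : X → Y → Bool} (hP : P.Computes f) (x : X)
    (y : Y) : P.switch.Joins x y 0 (if f x y then 2 else 1) := by
  obtain ⟨_, ⟨w, p, hp, hmax, rfl⟩, hn⟩ := hP x y
  have hB := map_some_not_adj_none (P.bob y)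
  obtain ⟨h₁, h₂⟩ := free_end_of_isPath (P.alice_isMatching x) (P.bob_map_isMatching y) hB hp hmax
  have hr : (P.graph x y).Reachable none w := p.reachable
  cases hf : f x y
  · rw [hf] at hn
    refine ((P.switch_reachable 0 hr).trans (Adj.reachable (Or.inl ?_))).trans
      (P.switch_reachable 1 hr.symm)
    exact fold_adj (by decide) (h₁ (hn.2 rfl))
  · have hodd : ¬ Even p.length := fun h => by simp [hn.1 h] at hf
    refine ((P.switch_reachable 0 hr).trans (Adj.reachable (Or.inr ?_))).trans
      (P.switch_reachable 2 hr.symm)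
    refine fold_adj (by decide) ⟨?_, h₂ hodd⟩
    -- A path that ends at the tap is empty, hence even. This is why Bob may leave the tap out of
    -- the glued vertices and keep the ports free.
    rintro rfl
    apply hodd
    rw [Walk.length_eq_zero_iff.2 (Walk.isPath_iff_nil.1 hp)]
    exact Even.zero

/-- There is a gadget with at most `c` vertices and three ports that joins port `0` to port `2` if
`f` takes the value `1` and to port `1` otherwise. -/
def HasSwitch (f : X → Y → Bool) (c : ℕ) : Prop :=
  ∃ G : Gadget X Y (Fin 3), G.size ≤ c ∧ ∀ x y, G.Joins x y 0 (if f x y then 2 else 1)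

theorem Protocol.Computes.hasSwitch {P : Protocol X Y s} {f : X → Y → Bool} (hP : P.Computes f) :
    HasSwitch f (3 * (s + 1)) := by
  refine ⟨P.switch, le_of_eq ?_, Protocol.joins_switch hP⟩
  change Fintype.card (Fin 3 × Option (Fin s)) = _
  simp

/-! ### Injective maps that depend on the input -/

section Realizes

variable {Q Q' Q'' : Type}

/-- A gadget with at most `c` vertices joins every entrance `q` to the exit `φ x y q`. -/
def Realizes (c : ℕ) (φ : X → Y → Q → Q') : Prop :=
  ∃ G : Gadget X Y (Q ⊕ Q'), G.size ≤ c ∧ ∀ x y q, G.Joins x y (Sum.inl q) (Sum.inr (φ x y q))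

theorem Realizes.mono {c c' : ℕ} {φ : X → Y → Q → Q'} (h : Realizes c φ) (hc : c ≤ c') :
    Realizes c' φ :=
  let ⟨G, h₁, h₂⟩ := h
  ⟨G, h₁.trans hc, h₂⟩

theorem realizes_const [Fintype Q] [Fintype Q'] {e : Q → Q'} (he : Function.Injective e) :
    Realizes (Fintype.card Q + Fintype.card Q') (fun (_ : X) (_ : Y) => e) := by
  let r : Q ⊕ Q' → Q ⊕ Q' → Prop := fun a b => ∃ q, a = Sum.inl q ∧ b = Sum.inr (e q)
  have h₃ : ∀ a b c, r a b → ¬ r b c := by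
    rintro _ _ _ ⟨q, rfl, rfl⟩ ⟨q', h, -⟩
    simp at h
  let G : Gadget X Y (Q ⊕ Q') :=
    { V := Q ⊕ Q'
      alice := fun _ => fromRel r
      bob := fun _ => ⊥
      alice_isMatching := fun _ => by
        refine isMatching_fromRel ?_ ?_ h₃
        · rintro _ _ _ ⟨q, rfl, rfl⟩ ⟨q', h, rfl⟩
          rw [Sum.inl_injective h]
        · rintro _ _ _ ⟨q, rfl, rfl⟩ ⟨q', rfl, h⟩
          rw [he (Sum.inr_injective h)]
      bob_isMatching := fun _ => isMatching_bot
      port := id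
      port_injective := Function.injective_id
      bob_free := fun _ _ _ h => h.elim }
  exact ⟨G, Fintype.card_sum.le,
    fun _ _ q => Adj.reachable (Or.inl (fromRel_adj_of_rel h₃ ⟨q, rfl, rfl⟩))⟩

theorem Realizes.comp {c c' : ℕ} {φ : X → Y → Q → Q'} {ψ : X → Y → Q' → Q''} (hψ : Realizes c' ψ)
    (hφ : Realizes c φ) : Realizes (c + c') (fun x y q => ψ x y (φ x y q)) := by
  obtain ⟨G, hG, hG'⟩ := hφ
  obtain ⟨H, hH, hH'⟩ := hψ
  let r : (Q ⊕ Q') ⊕ (Q' ⊕ Q'') → (Q ⊕ Q') ⊕ (Q' ⊕ Q'') → Prop :=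
    fun a b => ∃ q, a = Sum.inl (Sum.inr q) ∧ b = Sum.inr (Sum.inl q)
  have h₃ : ∀ a b c, r a b → ¬ r b c := by
    rintro _ _ _ ⟨q, rfl, rfl⟩ ⟨q', h, -⟩
    simp at h
  have hr : IsMatching (fromRel r) := by
    refine isMatching_fromRel ?_ ?_ h₃
    · rintro _ _ _ ⟨q, rfl, rfl⟩ ⟨q', h, rfl⟩
      simp_all
    · rintro _ _ _ ⟨q, rfl, rfl⟩ ⟨q', rfl, h⟩
      simp_all
  refine ⟨(G.sum H).wire (fromRel r) hr (Sum.map Sum.inl Sum.inr)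
    (Sum.map_injective.2 ⟨Sum.inl_injective, Sum.inr_injective⟩) ?_, ?_, fun x y q => ?_⟩
  · rintro (p | p) q ⟨-, ⟨q', h, h'⟩ | ⟨q', h, h'⟩⟩ <;> simp at h h'
  · exact (G.size_sum H).le.trans (add_le_add hG hH)
  · apply Gadget.joins_wire
    exact ((Gadget.WireJoins.of_joins (Gadget.joins_sum_inl H (hG' x y q))).trans
      (Gadget.WireJoins.of_adj (fromRel_adj_of_rel h₃ ⟨_, rfl, rfl⟩))).trans
      (Gadget.WireJoins.of_joins (Gadget.joins_sum_inr G (hH' x y _)))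

/-- Every entrance and every exit gets its own switch. The path leaves the entrance switch by the
port that belongs to the value of `f` and passes the exit switch backwards. Injectivity of `e₀` and
`e₁` makes the wiring a matching. -/
theorem HasSwitch.realizes [Fintype Q] [Fintype Q'] {f : X → Y → Bool} {c : ℕ} (h : HasSwitch f c)
    {e₀ e₁ : Q → Q'} (h₀ : Function.Injective e₀) (h₁ : Function.Injective e₁) :
    Realizes ((Fintype.card Q + Fintype.card Q') * c)
      (fun x y => if f x y then e₁ else e₀) := by
  obtain ⟨G, hG, hG'⟩ := h
  let r : (Q ⊕ Q') × Fin 3 → (Q ⊕ Q') × Fin 3 → Prop := fun a b =>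
    (∃ q, a = (Sum.inl q, 1) ∧ b = (Sum.inr (e₀ q), 1)) ∨
      (∃ q, a = (Sum.inl q, 2) ∧ b = (Sum.inr (e₁ q), 2))
  have h₃ : ∀ a b c, r a b → ¬ r b c := by
    rintro _ _ _ (⟨q, rfl, rfl⟩ | ⟨q, rfl, rfl⟩) (⟨q', h, -⟩ | ⟨q', h, -⟩) <;> simp at h
  have hr : IsMatching (fromRel r) := by
    refine isMatching_fromRel ?_ ?_ h₃
    · rintro _ _ _ (⟨q, rfl, rfl⟩ | ⟨q, rfl, rfl⟩) (⟨q', h, rfl⟩ | ⟨q', h, rfl⟩) <;> simp_all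
    · rintro _ _ _ (⟨q, rfl, rfl⟩ | ⟨q, rfl, rfl⟩) (⟨q', rfl, h⟩ | ⟨q', rfl, h⟩) <;>
        simp_all [h₀.eq_iff, h₁.eq_iff]
  refine ⟨(G.replicate (Q ⊕ Q')).wire (fromRel r) hr (fun t => (t, 0))
    (fun _ _ h => (Prod.ext_iff.1 h).1) ?_, ?_, fun x y q => ?_⟩
  · rintro p q ⟨-, (⟨q', h, -⟩ | ⟨q', h, -⟩) | (⟨q', -, h⟩ | ⟨q', -, h⟩)⟩ <;> simp at h
  · refine (G.size_replicate _).le.trans ?_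
    rw [Fintype.card_sum]
    exact Nat.mul_le_mul_left _ hG
  · apply Gadget.joins_wire
    have hj := hG' x y
    cases hf : f x y
    · simp only [hf, Bool.false_eq_true, if_false] at hj ⊢
      exact ((Gadget.WireJoins.of_joins (Gadget.joins_replicate _ hj)).trans
        (Gadget.WireJoins.of_adj (fromRel_adj_of_rel h₃ (Or.inl ⟨_, rfl, rfl⟩)))).trans
        (Gadget.WireJoins.of_joins (Gadget.joins_replicate _ hj.symm))
    · simp only [hf, if_true] at hj ⊢
      exact ((Gadget.WireJoins.of_joins (Gadget.joins_replicate _ hj)).trans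
        (Gadget.WireJoins.of_adj (fromRel_adj_of_rel h₃ (Or.inr ⟨_, rfl, rfl⟩)))).trans
        (Gadget.WireJoins.of_joins (Gadget.joins_replicate _ hj.symm))

end Realizes

/-! ### Garden-hose complexity -/

theorem GH_le_of_computes {f : X → Y → Bool} {s : ℕ} {P : Protocol X Y s} (hP : P.Computes f) :
    GH f ≤ s :=
  iInf₂_le s ⟨P, hP⟩

theorem exists_computes_of_GH_ne_top {f : X → Y → Bool} (h : GH f ≠ ⊤) :
    ∃ s : ℕ, GH f = s ∧ ∃ P : Protocol X Y s, P.Computes f := by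
  classical
  have hex : ∃ s : ℕ, ∃ P : Protocol X Y s, P.Computes f := by
    by_contra hne
    refine h ?_
    simp only [GH, iInf_eq_top]
    exact fun s hs => (hne ⟨s, hs⟩).elim
  refine ⟨Nat.find hex, le_antisymm ?_ ?_, Nat.find_spec hex⟩
  · obtain ⟨P, hP⟩ := Nat.find_spec hex
    exact GH_le_of_computes hP
  · exact le_iInf₂ fun s hs => Nat.cast_le.2 (Nat.find_min' hex hs)

theorem eq_false_of_computes {f : X → Y → Bool} {P : Protocol X Y 0} (hP : P.Computes f) (x : X)
    (y : Y) : f x y = false := by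
  obtain ⟨_, ⟨w, p, hp, -, rfl⟩, hn⟩ := hP x y
  obtain rfl : w = none := Subsingleton.elim _ _
  rw [← hn, Walk.length_eq_zero_iff.2 (Walk.isPath_iff_nil.1 hp)]
  exact Even.zero

theorem GH_eq_zero_of_eq_false {f : X → Y → Bool} (hf : ∀ x y, f x y = false) : GH f = 0 := by
  let P : Protocol X Y 0 := ⟨fun _ => ⊥, fun _ => ⊥, fun _ => isMatching_bot,
    fun _ => isMatching_bot⟩
  have hP : P.Computes f := fun x y =>
    ⟨0, ⟨none, Walk.nil, by simp, fun z _ => by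
      rw [Subsingleton.elim z none]; simp, rfl⟩, by simp [hf]⟩
  exact le_antisymm (GH_le_of_computes hP) bot_le

/-- The pipes of a protocol may form any finite type, and the path from the tap may be given by the
end vertex. -/
theorem GH_le_card {Ω : Type} [Fintype Ω] {A : X → SimpleGraph (Option Ω)} {B : Y → SimpleGraph Ω}
    (hA : ∀ x, IsMatching (A x)) (hB : ∀ y, IsMatching (B y)) {h : X → Y → Bool}
    (hend : ∀ x y, ∃ e : Ω,
      (A x ⊔ (B y).map Function.Embedding.some).Reachable none (some e) ∧
        if h x y then ∀ z, ¬ (B y).Adj e z else ∀ z, ¬ (A x).Adj (some e) z) :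
    GH h ≤ Fintype.card Ω := by
  let ε := Fintype.equivFin Ω
  have hε : Function.Injective (Option.map ε.symm) := Option.map_injective ε.symm.injective
  let P : Protocol X Y (Fintype.card Ω) :=
    { alice := fun x => (A x).comap (Option.map ε.symm)
      bob := fun y => (B y).comap ε.symm
      alice_isMatching := fun x => (hA x).comap hε
      bob_isMatching := fun y => (hB y).comap ε.symm.injective }
  refine GH_le_of_computes (P := P) fun x y => ?_
  obtain ⟨e, hr, he⟩ := hend x y
  let φ : A x ⊔ (B y).map Function.Embedding.some →g P.graph x y :=
    { toFun := Option.map ε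
      map_rel' := by
        rintro a b (hab | ⟨-, a, b, hab, rfl, rfl⟩)
        · refine Or.inl ?_
          change (A x).Adj (Option.map ε.symm (Option.map ε a)) (Option.map ε.symm (Option.map ε b))
          simpa using hab
        · refine Or.inr ⟨fun h => hab.ne ?_, ε a, ε b, ?_, rfl, rfl⟩
          · simpa using h
          · change (B y).Adj (ε.symm (ε a)) (ε.symm (ε b))
            simpa using hab }
  have hr' : (P.graph x y).Reachable none (some (ε e)) := hr.map φ
  obtain ⟨p, hp⟩ := hr'.exists_isPath
  obtain ⟨h₀, h₁⟩ := isPath_of_free_end (P.alice_isMatching x) (P.bob_map_isMatching y)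
    (map_some_not_adj_none _) (Option.some_ne_none _) hp
  cases hh : h x y
  · simp only [hh, Bool.false_eq_true, if_false] at he
    obtain ⟨hmax, hn⟩ := h₀ fun z hz => he (Option.map ε.symm z) (by
      have : (A x).Adj (Option.map ε.symm (some (ε e))) (Option.map ε.symm z) := hz
      simpa using this)
    exact ⟨_, ⟨_, p, hp, hmax, rfl⟩, iff_of_true hn rfl⟩
  · simp only [hh, if_true] at he
    obtain ⟨hmax, hn⟩ := h₁ fun z hz => by
      obtain ⟨-, a, b, hab, ha, -⟩ := hz
      obtain rfl : a = ε e := by simpa using ha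
      have : (B y).Adj (ε.symm (ε e)) (ε.symm b) := hab
      exact he _ (by simpa using this)
    exact ⟨_, ⟨_, p, hp, hmax, rfl⟩, iff_of_false hn (by simp)⟩

/-! ### Decision lists -/

/-- A gadget with at most `c` vertices joins a start port to a port whose label is the value
of `h`. -/
def Decides (c : ℕ) (h : X → Y → Bool) : Prop :=
  ∃ (P : Type) (G : Gadget X Y P) (start : P) (label : P → Bool), G.size ≤ c ∧
    ∀ x y, ∃ p, p ≠ start ∧ G.Joins x y start p ∧ label p = h x y

theorem Decides.mono {c c' : ℕ} {h : X → Y → Bool} (hh : Decides c h) (hc : c ≤ c') :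
    Decides c' h :=
  let ⟨P, G, start, label, h₁, h₂⟩ := hh
  ⟨P, G, start, label, h₁.trans hc, h₂⟩

theorem decides_const (b : Bool) : Decides 2 (fun (_ : X) (_ : Y) => b) := by
  obtain ⟨G, hG, hG'⟩ := realizes_const (X := X) (Y := Y) (Function.injective_id (α := Unit))
  exact ⟨_, G, Sum.inl (), fun _ => b, hG,
    fun x y => ⟨Sum.inr (), by simp, hG' x y (), rfl⟩⟩

/-- Run `φ` from the state `q₀` and, if the new state does not settle the outcome, run it backwards
and go on. -/
theorem Decides.step {Q Q' : Type} {c c' : ℕ} {φ : X → Y → Q → Q'} {h : X → Y → Bool}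
    (hφ : Realizes c φ) (hh : Decides c' h) (q₀ : Q) (D : Q' → Option Bool) :
    Decides (2 * c + c') (fun x y => (D (φ x y q₀)).getD (h x y)) := by
  obtain ⟨G, hG, hG'⟩ := hφ
  obtain ⟨P, H, start, label, hH, hH'⟩ := hh
  let r : (Bool × (Q ⊕ Q')) ⊕ P → (Bool × (Q ⊕ Q')) ⊕ P → Prop := fun a b =>
    (∃ q, D q = none ∧ a = Sum.inl (false, Sum.inr q) ∧ b = Sum.inl (true, Sum.inr q)) ∨
      (a = Sum.inl (true, Sum.inl q₀) ∧ b = Sum.inr start)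
  have h₃ : ∀ a b c, r a b → ¬ r b c := by
    rintro _ _ _ (⟨q, -, rfl, rfl⟩ | ⟨rfl, rfl⟩) (⟨q', -, h, -⟩ | ⟨h, -⟩) <;> simp at h
  have hr : IsMatching (fromRel r) := by
    refine isMatching_fromRel ?_ ?_ h₃
    · rintro _ _ _ (⟨q, -, rfl, rfl⟩ | ⟨rfl, rfl⟩) (⟨q', -, h, rfl⟩ | ⟨h, rfl⟩) <;>
        simp only [Sum.inl.injEq, Prod.mk.injEq, Sum.inr.injEq, reduceCtorEq, true_and,
          and_false] at h ⊢
      exact h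
    · rintro _ _ _ (⟨q, -, rfl, rfl⟩ | ⟨rfl, rfl⟩) (⟨q', -, rfl, h⟩ | ⟨rfl, h⟩) <;>
        simp only [Sum.inl.injEq, Prod.mk.injEq, Sum.inr.injEq, reduceCtorEq, true_and] at h ⊢
      exact h
  -- The ports left untouched by the wiring remain available, among them the start and the exits at
  -- which `D` has settled the outcome.
  let K := ((G.replicate Bool).sum H).wire (fromRel r) hr
    (Subtype.val : {p // ∀ q, ¬ (fromRel r).Adj p q} → _) Subtype.val_injective fun p => p.2
  refine ⟨_, K, ⟨Sum.inl (false, Sum.inl q₀), ?_⟩,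
    fun p => Sum.elim (fun t => Sum.elim (fun _ => true) (fun q => (D q).getD true) t.2) label p.1,
    ?_, fun x y => ?_⟩
  · rintro q ⟨-, (⟨q', -, h, -⟩ | ⟨h, -⟩) | (⟨q', -, -, h⟩ | ⟨-, h⟩)⟩ <;> simp at h
  · refine (Gadget.size_sum _ _).le.trans (add_le_add ?_ hH)
    rw [Gadget.size_replicate, Fintype.card_bool]
    exact Nat.mul_le_mul_left _ hG
  · have h₁ : Gadget.WireJoins ((G.replicate Bool).sum H) (fromRel r) x y
        (Sum.inl (false, Sum.inl q₀)) (Sum.inl (false, Sum.inr (φ x y q₀))) :=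
      Gadget.WireJoins.of_joins (Gadget.joins_sum_inl H (Gadget.joins_replicate _ (hG' x y q₀)))
    rcases hD : D (φ x y q₀) with _ | b
    · obtain ⟨p, hp, hp', hp''⟩ := hH' x y
      refine ⟨⟨Sum.inr p, ?_⟩, ?_, Gadget.joins_wire ?_, by simp [hD, hp'']⟩
      · rintro q ⟨-, (⟨q', -, h, -⟩ | ⟨h, -⟩) | (⟨q', -, -, h⟩ | ⟨-, h⟩)⟩ <;> simp at h
        exact hp h
      · simp
      · refine (((h₁.trans (Gadget.WireJoins.of_adj
          (fromRel_adj_of_rel h₃ (Or.inl ⟨_, hD, rfl, rfl⟩)))).trans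
          (Gadget.WireJoins.of_joins (Gadget.joins_sum_inl H (Gadget.joins_replicate _
            (hG' x y q₀).symm)))).trans (Gadget.WireJoins.of_adj
              (fromRel_adj_of_rel h₃ (Or.inr ⟨rfl, rfl⟩)))).trans
          (Gadget.WireJoins.of_joins (Gadget.joins_sum_inr _ hp'))
    · refine ⟨⟨Sum.inl (false, Sum.inr (φ x y q₀)), ?_⟩, ?_, Gadget.joins_wire h₁, ?_⟩
      · rintro q ⟨-, (⟨q', h', h, -⟩ | ⟨h, -⟩) | (⟨q', -, -, h⟩ | ⟨-, h⟩)⟩ <;> simp at h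
        subst h
        simp [hD] at h'
      · simp
      · simp [hD]

theorem Decides.GH_le {c : ℕ} {h : X → Y → Bool} (hh : Decides c h) : GH h ≤ (2 * c + 1 : ℕ) := by
  classical
  obtain ⟨P, G, start, label, hG, hG'⟩ := hh
  have : Finite P := Finite.of_injective _ G.port_injective
  have : Fintype P := Fintype.ofFinite P
  have hcard : Fintype.card (G.V ⊕ Option P) ≤ 2 * c + 1 := by
    have h₁ : Fintype.card P ≤ Fintype.card G.V :=
      Fintype.card_le_of_injective _ G.port_injective
    have h₂ : Fintype.card G.V ≤ c := hG
    simp only [Fintype.card_sum, Fintype.card_option]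
    omega
  refine le_trans ?_ (Nat.cast_le.2 hcard)
  let rA : Option (G.V ⊕ Option P) → Option (G.V ⊕ Option P) → Prop :=
    fun a b => a = none ∧ b = some (Sum.inr none)
  -- Alice joins the tap to one extra pipe, which Bob joins to the start. Bob also appends a pipe to
  -- each port labelled 0, so that the run ends on Alice's side there. At a port labelled 1 it stops
  -- on Bob's side.
  let rB : G.V ⊕ Option P → G.V ⊕ Option P → Prop := fun a b =>
    (a = Sum.inl (G.port start) ∧ b = Sum.inr none) ∨
      (∃ p, p ≠ start ∧ label p = false ∧ a = Sum.inl (G.port p) ∧ b = Sum.inr (some p))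
  have hA₃ : ∀ a b c, rA a b → ¬ rA b c := by
    rintro _ _ _ ⟨rfl, rfl⟩ ⟨h, -⟩
    simp at h
  have hB₃ : ∀ a b c, rB a b → ¬ rB b c := by
    rintro _ _ _ (⟨rfl, rfl⟩ | ⟨p, -, -, rfl, rfl⟩) (⟨h, -⟩ | ⟨p, -, -, h, -⟩) <;> simp at h
  refine GH_le_card
    (A := fun x => (G.alice x).map (fun v => some (Sum.inl v)) ⊔ fromRel rA)
    (B := fun y => (G.bob y).map Sum.inl ⊔ fromRel rB) (fun x => ?_) (fun y => ?_) fun x y => ?_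
  · refine ((G.alice_isMatching x).map ?_).sup (isMatching_fromRel ?_ ?_ hA₃) ?_
    · exact (Option.some_injective _).comp Sum.inl_injective
    · rintro _ _ _ ⟨rfl, rfl⟩ ⟨-, rfl⟩
      rfl
    · rintro _ _ _ ⟨rfl, rfl⟩ ⟨rfl, -⟩
      rfl
    · rintro _ _ _ ⟨-, v, w, -, rfl, rfl⟩ ⟨-, ⟨h, -⟩ | ⟨-, h⟩⟩ <;> simp at h
  · refine ((G.bob_isMatching y).map Sum.inl_injective).sup (isMatching_fromRel ?_ ?_ hB₃) ?_
    · rintro _ _ _ (⟨rfl, rfl⟩ | ⟨p, hp, -, rfl, rfl⟩) (⟨h, rfl⟩ | ⟨p', hp', -, h, rfl⟩)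
      · rfl
      · exact (hp' (G.port_injective (Sum.inl_injective h)).symm).elim
      · exact (hp (G.port_injective (Sum.inl_injective h))).elim
      · rw [G.port_injective (Sum.inl_injective h)]
    · rintro _ _ _ (⟨rfl, rfl⟩ | ⟨p, hp, -, rfl, rfl⟩) (⟨rfl, h⟩ | ⟨p', hp', -, rfl, h⟩) <;>
        simp_all
    · rintro _ _ _ ⟨-, v, w, hvw, rfl, rfl⟩
        ⟨-, (⟨h, -⟩ | ⟨p, -, -, h, -⟩) | (⟨-, h⟩ | ⟨p, -, -, -, h⟩)⟩
      · exact G.bob_free y start w (Sum.inl_injective h ▸ hvw)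
      · exact G.bob_free y p w (Sum.inl_injective h ▸ hvw)
      · simp at h
      · simp at h
  · obtain ⟨p, hp, hj, hl⟩ := hG' x y
    set A := (G.alice x).map (fun v => some (Sum.inl v : G.V ⊕ Option P)) ⊔ fromRel rA
    set B := (G.bob y).map (Sum.inl : _ → G.V ⊕ Option P) ⊔ fromRel rB with hBdef
    let φ : G.graph x y →g A ⊔ B.map Function.Embedding.some :=
      { toFun := fun v => some (Sum.inl v)
        map_rel' := by
          rintro a b (hab | hab)
          · exact Or.inl (Or.inl ⟨fun h => hab.ne (by simpa using h), a, b, hab, rfl, rfl⟩)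
          · exact Or.inr ⟨fun h => hab.ne (by simpa using h), _, _,
              Or.inl ⟨fun h => hab.ne (by simpa using h), a, b, hab, rfl, rfl⟩, rfl, rfl⟩ }
    have hB : ∀ {a b}, rB a b →
        (A ⊔ B.map Function.Embedding.some).Adj (some a) (some b) := fun {a b} h => by
      have h' := fromRel_adj_of_rel hB₃ h
      exact Or.inr ⟨fun e => h'.ne (by simpa using e), a, b, Or.inr h', rfl, rfl⟩
    have hr : (A ⊔ B.map Function.Embedding.some).Reachable none (some (Sum.inl (G.port p))) := by
      refine (Adj.reachable (Or.inl (Or.inr (fromRel_adj_of_rel hA₃ ⟨rfl, rfl⟩)))).trans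
        (Reachable.trans (Adj.reachable ?_) (Reachable.map φ hj))
      exact (hB (Or.inl ⟨rfl, rfl⟩)).symm
    cases hh : h x y
    · refine ⟨Sum.inr (some p), hr.trans (Adj.reachable (hB (Or.inr ⟨p, hp, hl.trans hh, rfl, rfl⟩))),
        ?_⟩
      simp only [Bool.false_eq_true, if_false]
      rintro z (⟨-, v, w, -, h, -⟩ | ⟨-, ⟨h, -⟩ | ⟨-, h⟩⟩) <;> simp at h
    · refine ⟨Sum.inl (G.port p), hr, ?_⟩
      simp only [if_true]
      rintro z (⟨-, v, w, hvw, h, -⟩ |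
        ⟨-, (⟨h, -⟩ | ⟨p', -, hl', h, -⟩) | (⟨-, h⟩ | ⟨p', -, -, -, h⟩)⟩)
      · exact G.bob_free y p w (Sum.inl_injective h ▸ hvw)
      · exact hp (G.port_injective (Sum.inl_injective h))
      · rw [← G.port_injective (Sum.inl_injective h), hl, hh] at hl'
        exact Bool.noConfusion hl'
      · simp at h
      · simp at h

variable {X : Type u} {Y : Type v} {ι : Type*} {f : ι → X → Y → Bool} {c : ι → ℕ} {J : Finset ι}

/-! ### Disjunction, conjunction and counting modulo `n` -/

/-- The state is one bit that starts at `false`; `f i` flips it or not. Four switches realize this,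
and the second, reversed copy doubles the number to 8. -/
theorem decides_exists (hc : ∀ i ∈ J, HasSwitch (f i) (c i)) :
    Decides (8 * (∑ i ∈ J, c i) + 2) (fun x y => decide (∃ i ∈ J, f i x y = true)) := by
  classical
  induction J using Finset.induction_on with
  | empty => simpa using decides_const (X := X) (Y := Y) false
  | insert i J hi ih =>
    have h := Decides.step ((hc i (Finset.mem_insert_self _ _)).realizes
      Function.injective_id Bool.not_injective)
      (ih fun j hj => hc j (Finset.mem_insert_of_mem hj)) false
      (fun b => if b then some true else none)
    convert h.mono (c' := 8 * (∑ i ∈ insert i J, c i) + 2) ?_ using 3 with x y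
    · cases hf : f i x y <;> simp [hf]
    · rw [Finset.sum_insert hi, Fintype.card_bool]
      omega

theorem decides_forall (hc : ∀ i ∈ J, HasSwitch (f i) (c i)) :
    Decides (8 * (∑ i ∈ J, c i) + 2) (fun x y => decide (∀ i ∈ J, f i x y = true)) := by
  classical
  induction J using Finset.induction_on with
  | empty => simpa using decides_const (X := X) (Y := Y) true
  | insert i J hi ih =>
    have h := Decides.step ((hc i (Finset.mem_insert_self _ _)).realizes
      Function.injective_id Bool.not_injective)
      (ih fun j hj => hc j (Finset.mem_insert_of_mem hj)) false
      (fun b => if b then none else some false)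
    convert h.mono (c' := 8 * (∑ i ∈ insert i J, c i) + 2) ?_ using 3 with x y
    · cases hf : f i x y <;> simp [hf]
    · rw [Finset.sum_insert hi, Fintype.card_bool]
      omega

/-- The number of functions in `J` that take the value `1`. -/
def count (f : ι → X → Y → Bool) (J : Finset ι) (x : X) (y : Y) : ℕ := ∑ i ∈ J, (f i x y).toNat

/-- Adding `a` or 0 is injective, so the same `n` states serve for all functions and the costs add
up. -/
theorem realizes_add_count (hc : ∀ i ∈ J, HasSwitch (f i) (c i)) (n : ℕ) [NeZero n] (a : ZMod n) :
    Realizes (2 * n * (∑ i ∈ J, c i) + 2 * n) (fun x y (q : ZMod n) => q + count f J x y • a) := by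
  classical
  induction J using Finset.induction_on with
  | empty =>
    convert (realizes_const (X := X) (Y := Y) (Function.injective_id (α := ZMod n))).mono
      (c' := 2 * n * (∑ i ∈ (∅ : Finset ι), c i) + 2 * n) ?_ using 4 with x y q
    · simp [count]
    · simp [ZMod.card]
      omega
  | insert i J hi ih =>
    have h := ((hc i (Finset.mem_insert_self _ _)).realizes Function.injective_id
      (add_left_injective a)).comp (ih fun j hj => hc j (Finset.mem_insert_of_mem hj))
    convert h.mono (c' := 2 * n * (∑ i ∈ insert i J, c i) + 2 * n) ?_ using 4 with x y q
    · rw [count, Finset.sum_insert hi, ← count]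
      cases hf : f i x y <;> simp [add_smul]
      ring
    · rw [Finset.sum_insert hi, ZMod.card]
      apply le_of_eq
      ring

theorem decides_odd (hc : ∀ i ∈ J, HasSwitch (f i) (c i)) :
    Decides (8 * (∑ i ∈ J, c i) + 10) (fun x y => decide (Odd (count f J x y))) := by
  have h := Decides.step (realizes_add_count hc 2 1) (decides_const false) 0
    (fun q => some (decide (q = 1)))
  convert h.mono (c' := 8 * (∑ i ∈ J, c i) + 10) (by omega) using 3 with x y
  simp [ZMod.natCast_eq_one_iff_odd]

/-! ### Rotations of finite cycles -/

/-- The point `q / n` of the circle agrees with `r` up to an error in `[0, ε]`. -/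
def Approx {n : ℕ} (q : ZMod n) (r ε : ℝ) : Prop :=
  ∃ (z : ℤ) (δ : ℝ), 0 ≤ δ ∧ δ ≤ ε ∧ r = q.val / n + δ + z

theorem Approx.mono {n : ℕ} {q : ZMod n} {r ε ε' : ℝ} (h : Approx q r ε) (hε : ε ≤ ε') :
    Approx q r ε' :=
  let ⟨z, δ, h₀, h₁, h₂⟩ := h
  ⟨z, δ, h₀, h₁.trans hε, h₂⟩

theorem exists_approx (n : ℕ) [NeZero n] (r : ℝ) : ∃ q : ZMod n, Approx q r (1 / n) := by
  have hn : (0 : ℝ) < n := Nat.cast_pos.2 (NeZero.pos n)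
  have h₀ : 0 ≤ Int.fract r * n := mul_nonneg (Int.fract_nonneg r) hn.le
  have hlt : ⌊Int.fract r * n⌋₊ < n := by
    rw [Nat.floor_lt h₀]
    nlinarith [Int.fract_lt_one r]
  have h₁ := Nat.floor_le h₀
  have h₂ := Nat.lt_floor_add_one (Int.fract r * n)
  refine ⟨(⌊Int.fract r * n⌋₊ : ℕ), ⌊r⌋, Int.fract r - ⌊Int.fract r * n⌋₊ / n, ?_, ?_, ?_⟩
  · rw [sub_nonneg, div_le_iff₀ hn]
    exact h₁
  · rw [sub_le_iff_le_add, ← add_div, le_div_iff₀ hn]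
    linarith
  · rw [ZMod.val_natCast_of_lt hlt]
    linarith [Int.floor_add_fract r]

theorem Approx.add_intCast {n : ℕ} [NeZero n] {q : ZMod n} {r ε : ℝ} (h : Approx q r ε) (a : ℤ) :
    Approx (q + (a : ZMod n)) (r + a / n) ε := by
  obtain ⟨z, δ, h₀, h₁, rfl⟩ := h
  have hn : (n : ℝ) ≠ 0 := Nat.cast_ne_zero.2 (NeZero.ne n)
  have hd : (n : ℤ) ∣ ((q.val : ℤ) + a) - ((q + (a : ZMod n)).val : ℤ) := by
    rw [← ZMod.intCast_eq_intCast_iff_dvd_sub]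
    push_cast
    simp
  obtain ⟨k, hk⟩ := hd
  refine ⟨z + k, δ, h₀, h₁, ?_⟩
  have hk' : (q.val : ℝ) + a = (q + (a : ZMod n)).val + n * k := by
    have : (q.val : ℤ) + a = (q + (a : ZMod n)).val + n * k := by omega
    exact_mod_cast this
  have : (q.val : ℝ) / n + a / n = (q + (a : ZMod n)).val / n + k := by
    rw [← add_div, hk', add_div, mul_div_cancel_left₀ _ hn]
  push_cast
  linarith

/-- Stretch a cycle by `16` points. -/
def stretch (g : ℕ) (q : ZMod (16 * g)) : ZMod (16 * (g + 1)) := ((q.val + q.val / g : ℕ) : ZMod _)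

theorem val_stretch {g : ℕ} (hg : 0 < g) (q : ZMod (16 * g)) :
    (stretch g q).val = q.val + q.val / g := by
  have : NeZero (16 * g) := ⟨by omega⟩
  have h₁ := ZMod.val_lt q
  have h₂ : q.val / g < 16 := Nat.div_lt_of_lt_mul (by omega)
  exact ZMod.val_natCast_of_lt (by omega)

theorem stretch_injective {g : ℕ} (hg : 0 < g) : Function.Injective (stretch g) := by
  have : NeZero (16 * g) := ⟨by omega⟩
  intro q q' h
  have h' := congrArg ZMod.val h
  rw [val_stretch hg, val_stretch hg] at h'
  apply ZMod.val_injective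
  rcases lt_trichotomy q.val q'.val with hlt | heq | hlt
  · have := Nat.div_le_div_right (c := g) hlt.le
    omega
  · exact heq
  · have := Nat.div_le_div_right (c := g) hlt.le
    omega

/-- The cycle consists of 16 blocks of `g` points, and each block gains one point. Block boundaries
stay in place, and a point at offset `b` in its block moves back by `b / (16 * g * (g + 1))`. Hence
errors always have the same sign. -/
theorem Approx.stretch {g : ℕ} (hg : 0 < g) {q : ZMod (16 * g)} {r ε : ℝ} (h : Approx q r ε) :
    Approx (stretch g q) r (ε + 1 / (16 * g)) := by
  obtain ⟨z, δ, h₀, h₁, rfl⟩ := h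
  have hg' : (0 : ℝ) < g := Nat.cast_pos.2 hg
  have key : (q.val : ℝ) / (16 * g : ℕ) - (GardenHose.stretch g q).val / (16 * (g + 1) : ℕ)
      = (q.val % g : ℕ) / (16 * g * (g + 1)) := by
    have hm : (q.val : ℝ) = g * (q.val / g : ℕ) + (q.val % g : ℕ) := by
      exact_mod_cast (Nat.div_add_mod q.val g).symm
    rw [val_stretch hg]
    push_cast at hm ⊢
    rw [div_sub_div _ _ (by positivity) (by positivity), div_eq_div_iff (by positivity)
      (by positivity)]
    linear_combination 256 * (g : ℝ) * (g + 1) * hm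
  refine ⟨z, δ + (q.val % g : ℕ) / (16 * g * (g + 1)), by positivity, add_le_add h₁ ?_, ?_⟩
  · have : ((q.val % g : ℕ) : ℝ) ≤ g := by exact_mod_cast (Nat.mod_lt _ hg).le
    rw [div_le_div_iff₀ (by positivity) (by positivity)]
    nlinarith
  · linarith

/-- The verdict of a point of the circle that is known up to an error in `[0, 1 / 8]`. -/
def verdict {n : ℕ} (q : ZMod n) : Option Bool :=
  if q.val = 0 ∨ 7 * n ≤ 8 * q.val then none else some (decide (2 * q.val < n))

/-- As `|r| ≤ 1 / 4`, positions below one half can only mean no wrap-around and the others a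
wrap-around. The sign is in doubt only at position 0 and in the last eighth of the circle, where an
error up to 1/8 may cross 0. -/
theorem verdict_cases {n : ℕ} [NeZero n] {q : ZMod n} {r : ℝ} (h : Approx q r (1 / 8))
    (hr : |r| ≤ 1 / 4) :
    (verdict q = none ∧ |r| ≤ 1 / 8) ∨ (verdict q = some true ∧ 0 < r) ∨
      (verdict q = some false ∧ r < 0) := by
  obtain ⟨z, δ, h₀, h₁, hz⟩ := h
  have hn : (0 : ℝ) < n := Nat.cast_pos.2 (NeZero.pos n)
  rw [abs_le] at hr
  set θ : ℝ := q.val / n with hθ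
  have hθn : (q.val : ℝ) = θ * n := (div_mul_cancel₀ _ hn.ne').symm
  have hθ₀ : 0 ≤ θ := by positivity
  have hθ₁ : θ < 1 := by
    rw [hθ, div_lt_one hn]
    exact_mod_cast ZMod.val_lt q
  have hz' : z = 0 ∨ z = -1 := by
    have h₂ : (z : ℝ) < 1 := by linarith
    have h₃ : (-2 : ℝ) < z := by linarith
    have h₂' : z < 1 := by exact_mod_cast h₂
    have h₃' : -2 < z := by exact_mod_cast h₃
    omega
  unfold verdict
  split_ifs with hv
  · refine Or.inl ⟨rfl, abs_le.2 ?_⟩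
    rcases hv with hv | hv
    · have : θ = 0 := by rw [hθ, hv]; simp
      rcases hz' with rfl | rfl <;> push_cast at hz <;> constructor <;> linarith
    · have hv' : (7 : ℝ) * n ≤ 8 * (θ * n) := by
        rw [← hθn]
        exact_mod_cast hv
      have : 7 / 8 ≤ θ := by
        by_contra hlt
        nlinarith
      rcases hz' with rfl | rfl <;> push_cast at hz <;> constructor <;> linarith
  · right
    rw [not_or, not_le] at hv
    have hpos : 0 < θ := by
      refine lt_of_le_of_ne hθ₀ fun e => hv.1 ?_
      rw [← e, zero_mul] at hθn
      exact_mod_cast hθn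
    have hlt : θ < 7 / 8 := by
      have hv' : 8 * (θ * n) < (7 : ℝ) * n := by
        rw [← hθn]
        exact_mod_cast hv.2
      by_contra hge
      nlinarith
    by_cases h2 : 2 * q.val < n
    · refine Or.inl ⟨by simp [h2], ?_⟩
      have h2' : 2 * (θ * n) < (n : ℝ) := by
        rw [← hθn]
        exact_mod_cast h2
      have : θ < 1 / 2 := by
        by_contra hge
        nlinarith
      rcases hz' with rfl | rfl <;> push_cast at hz <;> linarith
    · refine Or.inr ⟨by simp [h2], ?_⟩
      have h2' : (n : ℝ) ≤ 2 * (θ * n) := by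
        rw [← hθn]
        exact_mod_cast not_lt.1 h2
      have : 1 / 2 ≤ θ := by
        by_contra hge
        nlinarith
      rcases hz' with rfl | rfl <;> push_cast at hz <;> linarith

/-- Rotations by multiples of `1 / B, 1 / (B + 1), …, 1 / (B + t - 1)`, one after the other. -/
theorem exists_realizes_rotations (hc : ∀ i ∈ J, HasSwitch (f i) (c i)) {B : ℕ} (hB : 0 < B)
    (a : ℕ → ℤ) {t : ℕ} (ht : t ≤ B) :
    ∃ φ : X → Y → ZMod (16 * B) → ZMod (16 * (B + t)),
      Realizes (32 * B + t * (64 * B * (∑ i ∈ J, c i) + 128 * B)) φ ∧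
      ∀ x y q r ε, Approx q r ε → Approx (φ x y q)
        (r + count f J x y * ∑ i ∈ Finset.range t, (a i : ℝ) / (B + i)) (ε + t / (16 * B)) := by
  induction t with
  | zero =>
    have : NeZero (16 * B) := ⟨by omega⟩
    refine ⟨fun _ _ q => q, (realizes_const Function.injective_id).mono ?_, ?_⟩
    · simp only [ZMod.card]
      omega
    · intro x y q r ε h
      simpa using h
  | succ t ih =>
    obtain ⟨φ, hφ, hφ'⟩ := ih (by omega)
    have : NeZero (16 * (B + t)) := ⟨by omega⟩
    have : NeZero (16 * (B + t + 1)) := ⟨by omega⟩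
    -- On `16 * (B + t)` points, adding `16 * a t` rotates the circle by exactly `a t / (B + t)`.
    -- Only the passage to the next cycle causes an error.
    refine ⟨fun x y q => stretch (B + t)
      (φ x y q + count f J x y • ((16 * a t : ℤ) : ZMod (16 * (B + t)))),
      ((realizes_const (stretch_injective (g := B + t) (by omega))).comp
        ((realizes_add_count hc _ _).comp hφ)).mono ?_, ?_⟩
    · simp only [ZMod.card]
      have h₁ : 2 * (16 * (B + t)) * (∑ i ∈ J, c i) ≤ 64 * B * ∑ i ∈ J, c i :=
        Nat.mul_le_mul_right _ (by omega)
      rw [add_mul t 1, one_mul]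
      omega
    · intro x y q r ε h
      have h₁ := ((hφ' x y q r ε h).add_intCast (count f J x y * (16 * a t))).stretch
        (g := B + t) (by omega)
      have h₂ : φ x y q + ((count f J x y * (16 * a t) : ℤ) : ZMod (16 * (B + t))) =
          φ x y q + count f J x y • ((16 * a t : ℤ) : ZMod (16 * (B + t))) := by
        rw [nsmul_eq_mul]
        push_cast
        rfl
      have hB' : (0 : ℝ) < B := Nat.cast_pos.2 hB
      rw [h₂] at h₁
      have hr : r + count f J x y * ∑ i ∈ Finset.range (t + 1), (a i : ℝ) / (B + i) =
          r + count f J x y * ∑ i ∈ Finset.range t, (a i : ℝ) / (B + i) +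
            ((count f J x y * (16 * a t) : ℤ) : ℝ) / (16 * (B + t) : ℕ) := by
        rw [Finset.sum_range_succ]
        push_cast
        field_simp
        ring
      rw [hr]
      refine h₁.mono ?_
      have : 1 / (16 * ((B + t : ℕ) : ℝ)) ≤ 1 / (16 * B) := by
        apply one_div_le_one_div_of_le (by positivity)
        push_cast
        nlinarith [Nat.cast_nonneg (α := ℝ) t]
      push_cast [add_div] at this ⊢
      linarith

/-! ### A short sum of small fractions -/

theorem fwdDiff_iter_inv (n : ℕ) {x : ℝ} (hx : 0 < x) :
    (fwdDiff (1 : ℝ))^[n] (fun y => y⁻¹) x =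
      (-1) ^ n * n.factorial / ∏ i ∈ Finset.range (n + 1), (x + i) := by
  induction n generalizing x with
  | zero => simp
  | succ n ih =>
    rw [Function.iterate_succ_apply', fwdDiff, ih hx, ih (by linarith)]
    have h₁ : ∏ i ∈ Finset.range (n + 2), (x + i) =
        (∏ i ∈ Finset.range (n + 1), (x + 1 + i)) * x := by
      rw [Finset.prod_range_succ']
      push_cast
      simp only [add_zero]
      congr 1
      exact Finset.prod_congr rfl fun i _ => by ring
    have h₂ : ∏ i ∈ Finset.range (n + 2), (x + i) =
        (∏ i ∈ Finset.range (n + 1), (x + i)) * (x + (n + 1)) := by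
      rw [Finset.prod_range_succ]
      push_cast
      rfl
    have p₁ : 0 < ∏ i ∈ Finset.range (n + 1), (x + i) :=
      Finset.prod_pos fun i _ => by positivity
    have p₂ : 0 < ∏ i ∈ Finset.range (n + 1), (x + 1 + i) :=
      Finset.prod_pos fun i _ => by positivity
    -- Both sides are the product of `n + 2` factors, with the first or the last one split off.
    have hR := h₁.symm.trans h₂
    rw [h₁, div_sub_div _ _ p₂.ne' p₁.ne', div_eq_div_iff (by positivity) (by positivity),
      Nat.factorial_succ]
    push_cast
    rw [pow_succ]
    linear_combination (-((-1) ^ n * (n.factorial : ℝ) *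
      (∏ i ∈ Finset.range (n + 1), (x + 1 + i)))) * hR

/-- The numerators of a representation of `1 / ((2 n + 1) * n.centralBinom)`. -/
def numerator (n i : ℕ) : ℤ := (-1) ^ i * n.choose i

/-- Up to sign the left side is the `n`-th forward difference of `1 / x` at `n + 1`, which is `n! /
((n + 1) ⋯ (2 * n + 1))` in absolute value. -/
theorem sum_numerator_div (n : ℕ) :
    ∑ i ∈ Finset.range (n + 1), (numerator n i : ℝ) / ((n + 1 : ℕ) + i) =
      1 / ((2 * n + 1) * n.centralBinom : ℕ) := by
  have hx : (0 : ℝ) < (n + 1 : ℕ) := by positivity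
  have h := fwdDiff_iter_inv n hx
  rw [fwdDiff_iter_eq_sum_shift] at h
  have h₁ : ∏ i ∈ Finset.range (n + 1), (((n + 1 : ℕ) : ℝ) + i) = (n + 1).ascFactorial (n + 1) := by
    rw [Nat.ascFactorial_eq_prod_range]
    push_cast
    rfl
  have h₂ : (n.factorial : ℝ) * (n + 1).ascFactorial (n + 1) =
      (2 * n + 1) * n.centralBinom * (n.factorial * n.factorial) := by
    have e₁ := Nat.factorial_mul_ascFactorial n (n + 1)
    have e₂ := Nat.choose_mul_factorial_mul_factorial (n := 2 * n) (k := n) (by omega)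
    rw [show 2 * n - n = n by omega] at e₂
    have e₃ : (n + (n + 1)).factorial = (2 * n + 1) * (2 * n).factorial := by
      rw [show n + (n + 1) = 2 * n + 1 by ring, Nat.factorial_succ]
    rw [e₃, ← e₂] at e₁
    rw [Nat.centralBinom_eq_two_mul_choose]
    exact_mod_cast e₁.trans (by ring)
  have h₃ : ∑ i ∈ Finset.range (n + 1), (numerator n i : ℝ) / ((n + 1 : ℕ) + i) =
      (-1) ^ n * ∑ i ∈ Finset.range (n + 1), ((-1 : ℤ) ^ (n - i) * n.choose i) •
        (((n + 1 : ℕ) : ℝ) + i • (1 : ℝ))⁻¹ := by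
    rw [Finset.mul_sum]
    refine Finset.sum_congr rfl fun i hi => ?_
    obtain ⟨m, rfl⟩ : ∃ m, n = i + m := ⟨n - i, by have := Finset.mem_range.1 hi; omega⟩
    have hs : ((-1 : ℝ) ^ m) * (-1) ^ m = 1 := by rw [← mul_pow]; simp
    rw [numerator, show i + m - i = m by omega, zsmul_eq_mul, nsmul_eq_mul, mul_one, div_eq_mul_inv,
      pow_add]
    push_cast
    linear_combination (-((-1) ^ i * ((i + m).choose i : ℝ) * ((i : ℝ) + m + 1 + i)⁻¹)) * hs
  have hs : ((-1 : ℝ) ^ n) * (-1) ^ n = 1 := by rw [← mul_pow]; simp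
  have hf : (n.factorial : ℝ) ≠ 0 := Nat.cast_ne_zero.2 n.factorial_ne_zero
  have hb : ((n.centralBinom : ℕ) : ℝ) ≠ 0 := Nat.cast_ne_zero.2 n.centralBinom_ne_zero
  have ha : ((n + 1).ascFactorial (n + 1) : ℝ) ≠ 0 := by
    rw [← h₁]
    exact (Finset.prod_pos fun i _ => by positivity).ne'
  rw [h₃, h, h₁, ← mul_div_assoc, ← mul_assoc, hs, one_mul, div_eq_div_iff ha
    (by push_cast; positivity)]
  push_cast
  have := mul_left_cancel₀ hf (a := (n.factorial : ℝ))
    (b := n.factorial * ((2 * n + 1) * n.centralBinom)) (c := 1 * (n + 1).ascFactorial (n + 1)) ?_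
  · exact this
  · linear_combination -h₂

/-- This makes the coarsest angle small enough that no count up to `k` leaves the quarter circle
around 0. -/
theorem four_pow_le_centralBinom (n : ℕ) : 4 ^ n ≤ (2 * n + 1) * n.centralBinom := by
  rw [Nat.centralBinom_eq_two_mul_choose]
  exact Nat.four_pow_le_two_mul_add_one_mul_central_binom n

/-- This bounds the number of doublings until the angle per function is at least a full turn. -/
theorem centralBinom_le_pow (n : ℕ) : (2 * n + 1) * n.centralBinom ≤ 2 ^ (4 * n) := by
  have h₁ : n.centralBinom ≤ 2 ^ (2 * n) := by
    rw [Nat.centralBinom_eq_two_mul_choose]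
    exact Nat.choose_le_two_pow _ _
  have h₂ : 2 * n + 1 ≤ 2 ^ (2 * n) := Nat.lt_two_pow_self
  calc (2 * n + 1) * n.centralBinom ≤ 2 ^ (2 * n) * 2 ^ (2 * n) := Nat.mul_le_mul h₂ h₁
    _ = 2 ^ (4 * n) := by rw [← pow_add]; congr 1; ring

/-! ### Thresholds -/

/-- A bound for the size of the gadget that computes the difference between the number of ones and
the threshold at one scale. -/
def scaleCost (n S : ℕ) : ℕ := 32 * (n + 1) + (n + 1) * (64 * (n + 1) * S + 128 * (n + 1))

/-- The scales `4 n - m, …, 4 n - 1`, where scale `j` resolves differences of about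
`(2 n + 1) * n.centralBinom / 2 ^ j`. -/
theorem exists_decides_scales (hc : ∀ i ∈ J, HasSwitch (f i) (c i)) (n T : ℕ) {m : ℕ}
    (hm : m ≤ 4 * n) :
    ∃ h : X → Y → Bool, Decides (2 + m * (2 * scaleCost n (∑ i ∈ J, c i))) h ∧
      ∀ x y, |(2 : ℝ) ^ (4 * n - m) / ((2 * n + 1) * n.centralBinom : ℕ) *
        (count f J x y - T)| ≤ 1 / 4 → h x y = decide (T ≤ count f J x y) := by
  have hD : (0 : ℝ) < ((2 * n + 1) * n.centralBinom : ℕ) :=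
    Nat.cast_pos.2 (Nat.mul_pos (by omega) n.centralBinom_pos)
  induction m with
  | zero =>
    refine ⟨_, (decides_const true).mono (by omega), fun x y h => ?_⟩
    -- Beyond the finest scale the hypothesis forces the count to equal `T`, so the constant `true`
    -- is correct.
    have h₁ : 1 ≤ (2 : ℝ) ^ (4 * n - 0) / ((2 * n + 1) * n.centralBinom : ℕ) := by
      rw [one_le_div hD]
      exact_mod_cast centralBinom_le_pow n
    rw [abs_mul, abs_of_nonneg (by positivity)] at h
    have h₂ : |(count f J x y : ℝ) - T| < 1 := by
      nlinarith [abs_nonneg ((count f J x y : ℝ) - T)]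
    have h₃ : ((T : ℝ)) < count f J x y + 1 := by linarith [(abs_lt.1 h₂).1]
    have h₄ : T < count f J x y + 1 := by exact_mod_cast h₃
    exact (decide_eq_true (by omega)).symm
  | succ m ih =>
    obtain ⟨h, hh, hh'⟩ := ih (by omega)
    set D : ℝ := (((2 * n + 1) * n.centralBinom : ℕ) : ℝ) with hDdef
    set j := 4 * n - (m + 1) with hj
    have hj' : 4 * n - m = j + 1 := by omega
    rw [hj'] at hh'
    obtain ⟨φ, hφ, hφ'⟩ := exists_realizes_rotations hc (B := n + 1) (by omega)
      (fun i => 2 ^ j * numerator n i) le_rfl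
    have : NeZero (16 * (n + 1)) := ⟨by omega⟩
    have : NeZero (16 * (n + 1 + (n + 1))) := ⟨by omega⟩
    -- Starting near the angle `-(2 ^ j / D * T)` turns the comparison with `T` into a sign test.
    obtain ⟨q₀, hq₀⟩ := exists_approx (16 * (n + 1)) (-((2 : ℝ) ^ j / D * T))
    refine ⟨_, (Decides.step hφ hh q₀ verdict).mono (le_of_eq ?_), fun x y hxy => ?_⟩
    · rw [scaleCost]
      ring
    · have hα : ∑ i ∈ Finset.range (n + 1),
          ((2 ^ j * numerator n i : ℤ) : ℝ) / ((n + 1 : ℕ) + i) = 2 ^ j / D := by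
        rw [div_eq_mul_one_div, hDdef, ← sum_numerator_div n, Finset.mul_sum]
        refine Finset.sum_congr rfl fun i _ => ?_
        push_cast
        ring
      have happ := hφ' x y q₀ _ _ hq₀
      rw [hα] at happ
      have hr : -((2 : ℝ) ^ j / D * T) + count f J x y * (2 ^ j / D) =
          2 ^ j / D * (count f J x y - T) := by ring
      rw [hr] at happ
      have hpos : (0 : ℝ) < 2 ^ j / D := by positivity
      -- One rounding of the initial angle and `n + 1` stretchings, each costing at most `1 / (16 *
      -- (n + 1))`; the factor 16 in the cycle lengths is chosen for this bound.
      have herr : 1 / ((16 * (n + 1) : ℕ) : ℝ) + ((n + 1 : ℕ) : ℝ) / (16 * (n + 1 : ℕ)) ≤ 1 / 8 := by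
        have hn : (0 : ℝ) ≤ n := Nat.cast_nonneg n
        push_cast
        rw [← add_div, div_le_div_iff₀ (by positivity) (by norm_num)]
        nlinarith
      rcases verdict_cases (happ.mono herr) hxy with ⟨hv, hs⟩ | ⟨hv, hs⟩ | ⟨hv, hs⟩
      · rw [hv, Option.getD_none]
        refine hh' x y ?_
        rw [pow_succ, mul_comm _ (2 : ℝ), mul_div_assoc, mul_assoc, abs_mul,
          abs_of_pos (by norm_num : (0 : ℝ) < 2)]
        linarith
      · rw [hv, Option.getD_some]
        have h₁ := (mul_pos_iff_of_pos_left hpos).1 hs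
        have h₂ : (T : ℝ) < count f J x y := by linarith
        have h₃ : T < count f J x y := by exact_mod_cast h₂
        exact (decide_eq_true h₃.le).symm
      · rw [hv, Option.getD_some]
        have h₁ : (count f J x y : ℝ) - T < 0 := by
          by_contra hge
          exact absurd hs (not_lt.2 (mul_nonneg hpos.le (not_lt.1 hge)))
        have h₂ : (count f J x y : ℝ) < T := by linarith
        have h₃ : count f J x y < T := by exact_mod_cast h₂
        exact (decide_eq_false (by omega)).symm

theorem decides_threshold (hc : ∀ i ∈ J, HasSwitch (f i) (c i)) {n k T : ℕ} (hJ : J.card ≤ k)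
    (hT : T ≤ k) (hk : 4 * k ≤ 4 ^ n) :
    Decides (2 + 4 * n * (2 * scaleCost n (∑ i ∈ J, c i)))
      (fun x y => decide (T ≤ count f J x y)) := by
  obtain ⟨h, hh, hh'⟩ := exists_decides_scales hc n T le_rfl
  convert hh using 3 with x y
  refine (hh' x y ?_).symm
  have hD : ((4 * k : ℕ) : ℝ) ≤ ((2 * n + 1) * n.centralBinom : ℕ) :=
    Nat.cast_le.2 (hk.trans (four_pow_le_centralBinom n))
  have hD' : (0 : ℝ) < ((2 * n + 1) * n.centralBinom : ℕ) :=
    Nat.cast_pos.2 (Nat.mul_pos (by omega) n.centralBinom_pos)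
  have hcount : count f J x y ≤ k := by
    refine le_trans ?_ hJ
    rw [Finset.card_eq_sum_ones]
    exact Finset.sum_le_sum fun i _ => Bool.toNat_le _
  have h₁ : |(count f J x y : ℝ) - T| ≤ k := by
    have a₁ : (count f J x y : ℝ) ≤ k := Nat.cast_le.2 hcount
    have a₂ : (T : ℝ) ≤ k := Nat.cast_le.2 hT
    rw [abs_le]
    constructor <;> linarith [Nat.cast_nonneg (α := ℝ) (count f J x y), Nat.cast_nonneg (α := ℝ) T]
  rw [Nat.sub_self, pow_zero, abs_mul, abs_of_pos (by positivity), one_div, inv_mul_le_iff₀ hD']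
  push_cast at hD ⊢
  linarith

/-! ### Dropping the functions that vanish -/

section Main

variable {k : ℕ} {f : Fin k → X → Y → Bool} {s : Fin k → ℕ}

theorem ones_eq_count {J : Finset (Fin k)} (hJ : ∀ i ∉ J, ∀ x y, f i x y = false) (x : X) (y : Y) :
    ones (fun i => f i x y) = count f J x y := by
  refine (Finset.sum_subset (Finset.subset_univ J) fun i _ hi => ?_).symm
  simp [hJ i hi]

/-- Functions without pipes are dropped because a switch has `3 * (s + 1)` vertices, which is at
most `6 * s` only for `s ≥ 1`. A nonempty `J` also lets the sum absorb the additive constants. -/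
theorem GH_le_of_nonvanishing {J : Finset (Fin k)} (hJ : ∀ i ∉ J, ∀ x y, f i x y = false)
    (hne : J.Nonempty) (hs : ∀ i ∈ J, s i ≠ 0)
    (hf : ∀ i ∈ J, ∃ P : Protocol X Y (s i), P.Computes (f i)) :
    GH (comp OR f) ≤ (200 * ∑ i ∈ J, s i : ℕ) ∧ GH (comp AND f) ≤ (200 * ∑ i ∈ J, s i : ℕ) ∧
      GH (comp XOR f) ≤ (200 * ∑ i ∈ J, s i : ℕ) ∧
      ∀ n, 4 * k ≤ 4 ^ n → GH (comp MAJ f) ≤ (22000 * (n + 1) ^ 3 * ∑ i ∈ J, s i : ℕ) := by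
  have hc : ∀ i ∈ J, HasSwitch (f i) (6 * s i) := fun i hi => by
    obtain ⟨P, hP⟩ := hf i hi
    obtain ⟨G, hG, hG'⟩ := hP.hasSwitch
    have := Nat.pos_of_ne_zero (hs i hi)
    exact ⟨G, by omega, hG'⟩
  have hpos : 1 ≤ ∑ i ∈ J, s i := by
    obtain ⟨i, hi⟩ := hne
    exact (Nat.one_le_iff_ne_zero.2 (hs i hi)).trans (Finset.single_le_sum (by simp) hi)
  have hsum : ∑ i ∈ J, 6 * s i = 6 * ∑ i ∈ J, s i := (Finset.mul_sum _ _ _).symm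
  set S := ∑ i ∈ J, s i with hS
  refine ⟨?_, ?_, ?_, fun n hn => ?_⟩
  · have h := (decides_exists hc).GH_le
    rw [hsum] at h
    refine le_trans (le_of_eq ?_) (h.trans (Nat.cast_le.2 (by omega)))
    congr 1
    ext x y
    simp only [comp, OR, decide_eq_decide]
    refine ⟨fun ⟨i, hi⟩ => ⟨i, ?_, hi⟩, fun ⟨i, _, hi⟩ => ⟨i, hi⟩⟩
    by_contra hiJ
    simp [hJ i hiJ] at hi
  · by_cases hall : ∀ i, i ∈ J
    · have h := (decides_forall hc).GH_le
      rw [hsum] at h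
      refine le_trans (le_of_eq ?_) (h.trans (Nat.cast_le.2 (by omega)))
      congr 1
      ext x y
      simp [comp, AND, hall]
    · obtain ⟨i, hi⟩ := not_forall.1 hall
      rw [GH_eq_zero_of_eq_false]
      · exact bot_le
      · intro x y
        simp only [comp, AND, decide_eq_false_iff_not]
        exact fun h => by simpa [hJ i hi] using h i
  · have h := (decides_odd hc).GH_le
    rw [hsum] at h
    refine le_trans (le_of_eq ?_) (h.trans (Nat.cast_le.2 (by omega)))
    congr 1
    ext x y
    simp only [comp, XOR, ones_eq_count hJ]
  -- The threshold is `k / 2` rounded up, with the original `k`: dropped functions still count as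
  -- zeros.
  · have h := (decides_threshold (k := k) (T := (k + 1) / 2) hc
      ((Finset.card_le_univ J).trans_eq (Fintype.card_fin k)) (by omega) hn).GH_le
    rw [hsum] at h
    refine le_trans (le_of_eq ?_) (h.trans (Nat.cast_le.2 ?_))
    · congr 1
      ext x y
      simp only [comp, MAJ, ones_eq_count hJ, decide_eq_decide]
      omega
    -- Here 544 = 32 + 64 * 6 + 128.
    · have h₁ : scaleCost n (6 * S) ≤ 544 * (n + 1) ^ 2 * S := by
        rw [scaleCost]
        nlinarith [Nat.mul_le_mul_left ((n + 1) ^ 2) hpos, Nat.mul_le_mul_left (n + 1) hpos,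
          Nat.zero_le (n * S), Nat.zero_le (n ^ 2 * S)]
      have h₂ : n * scaleCost n (6 * S) ≤ (n + 1) * (544 * (n + 1) ^ 2 * S) :=
        Nat.mul_le_mul (Nat.le_succ n) h₁
      have h₃ : 1 ≤ (n + 1) ^ 3 * S := Nat.mul_pos (by positivity) hpos
      nlinarith

end Main

end GardenHose

theorem mainTheorem6 :
    ∃ C : ℕ, ∀ (k : ℕ) (X : Type u) (Y : Type v) (f : Fin k → X → Y → Bool),
      (1 ≤ k →
        GardenHose.GH (GardenHose.comp GardenHose.OR f) ≤ C * ∑ i, GardenHose.GH (f i) ∧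
        GardenHose.GH (GardenHose.comp GardenHose.AND f) ≤ C * ∑ i, GardenHose.GH (f i) ∧
        GardenHose.GH (GardenHose.comp GardenHose.XOR f) ≤ C * ∑ i, GardenHose.GH (f i)) ∧
      (2 ≤ k →
        (GardenHose.GH (GardenHose.comp GardenHose.MAJ f) : ℝ≥0∞) ≤
          C * ((∑ i, GardenHose.GH (f i) : ℕ∞) : ℝ≥0∞) *
            ENNReal.ofReal (Real.log k ^ 3)) := by
  -- The constant exceeds 22000 * 6 ^ 3, where 6 comes from `Nat.log 2 k + 3 ≤ 6 * Real.log k`.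
  refine ⟨5000000, fun k X Y f => ?_⟩
  have hlog : ∀ k : ℕ, 2 ≤ k → 0 < Real.log k := fun k hk =>
    Real.log_pos (by exact_mod_cast hk)
  by_cases htop : ∀ i, GardenHose.GH (f i) ≠ ⊤
  · choose s hs hP using fun i => GardenHose.exists_computes_of_GH_ne_top (htop i)
    have hsum : ∑ i, GardenHose.GH (f i) = ((∑ i, s i : ℕ) : ℕ∞) := by
      rw [Nat.cast_sum]
      exact Finset.sum_congr rfl fun i _ => hs i
    rw [hsum]
    have hJ : ∀ i ∉ Finset.univ.filter (fun i => s i ≠ 0), ∀ x y, f i x y = false := by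
      intro i hi x y
      have hi' : s i = 0 := by simpa using hi
      obtain ⟨P, hPf⟩ := hP i
      revert P
      rw [hi']
      exact fun P hPf => GardenHose.eq_false_of_computes hPf x y
    have hJsum : ∑ i ∈ Finset.univ.filter (fun i => s i ≠ 0), s i = ∑ i, s i :=
      Finset.sum_filter_ne_zero _
    rcases (Finset.univ.filter (fun i => s i ≠ 0)).eq_empty_or_nonempty with hemp | hne
    · have hf : ∀ i x y, f i x y = false := fun i => hJ i (by simp [hemp])
      refine ⟨fun hk => ⟨?_, ?_, ?_⟩, fun hk => ?_⟩
      · rw [GardenHose.GH_eq_zero_of_eq_false fun x y => by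
          simp [GardenHose.comp, GardenHose.OR, hf]]
        exact bot_le
      · rw [GardenHose.GH_eq_zero_of_eq_false fun x y => by
          simp only [GardenHose.comp, GardenHose.AND, hf, decide_eq_false_iff_not]
          exact fun h => Bool.noConfusion (h ⟨0, hk⟩)]
        exact bot_le
      · rw [GardenHose.GH_eq_zero_of_eq_false fun x y => by
          simp [GardenHose.comp, GardenHose.XOR, GardenHose.ones, hf]]
        exact bot_le
      · rw [GardenHose.GH_eq_zero_of_eq_false fun x y => by
          simp only [GardenHose.comp, GardenHose.MAJ, GardenHose.ones, hf, decide_eq_false_iff_not]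
          simp
          omega]
        simp
    · obtain ⟨h₁, h₂, h₃, h₄⟩ := GardenHose.GH_le_of_nonvanishing hJ hne
        (fun i hi => (Finset.mem_filter.1 hi).2) (fun i _ => hP i)
      rw [hJsum] at h₁ h₂ h₃ h₄
      have hle : ((200 * ∑ i, s i : ℕ) : ℕ∞) ≤ (5000000 : ℕ) * ((∑ i, s i : ℕ) : ℕ∞) := by
        rw [← Nat.cast_mul]
        exact Nat.cast_le.2 (Nat.mul_le_mul_right _ (by norm_num))
      refine ⟨fun _ => ⟨h₁.trans hle, h₂.trans hle, h₃.trans hle⟩, fun hk => ?_⟩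
      set S := ∑ i, s i
      have hlogk := Nat.lt_pow_succ_log_self (b := 2) (by norm_num) k
      have hk1 : 1 ≤ Nat.log 2 k := Nat.log_pos (by norm_num) hk
      have hn : 4 * k ≤ 4 ^ (Nat.log 2 k + 2) := by
        have : (2 : ℕ) ^ (Nat.log 2 k + 1) ≤ 4 ^ (Nat.log 2 k + 1) :=
          Nat.pow_le_pow_left (by norm_num) _
        rw [pow_succ 4 (Nat.log 2 k + 1)]
        have := hlogk.le
        rw [Nat.succ_eq_add_one] at this
        omega
      have h₅ := h₄ _ hn
      have h₆ : ((Nat.log 2 k + 2 + 1 : ℕ) : ℝ) ≤ 6 * Real.log k := by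
        have a₁ : (2 : ℝ) ^ (Nat.log 2 k) ≤ k := by
          exact_mod_cast Nat.pow_log_le_self 2 (by omega)
        have a₂ := Real.log_le_log (by positivity) a₁
        rw [Real.log_pow] at a₂
        have a₃ : (1 : ℝ) ≤ Nat.log 2 k := by exact_mod_cast hk1
        have a₄ := Real.log_two_gt_d9
        push_cast
        nlinarith
      have h₇ : ((22000 * (Nat.log 2 k + 2 + 1) ^ 3 * S : ℕ) : ℝ) ≤
          5000000 * S * Real.log k ^ 3 := by
        have a₁ : ((Nat.log 2 k + 2 + 1 : ℕ) : ℝ) ^ 3 ≤ (6 * Real.log k) ^ 3 :=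
          pow_le_pow_left₀ (by positivity) h₆ 3
        have a₂ : (0 : ℝ) ≤ S * Real.log k ^ 3 :=
          mul_nonneg (Nat.cast_nonneg _) (pow_nonneg (hlog k hk).le 3)
        have a₃ := mul_le_mul_of_nonneg_left a₁ (Nat.cast_nonneg (α := ℝ) S)
        push_cast at a₁ a₃ ⊢
        nlinarith
      calc (GardenHose.GH (GardenHose.comp GardenHose.MAJ f) : ℝ≥0∞)
          ≤ (((22000 * (Nat.log 2 k + 2 + 1) ^ 3 * S : ℕ) : ℕ∞) : ℝ≥0∞) :=
            ENat.toENNReal_le.2 h₅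
        _ = ENNReal.ofReal ((22000 * (Nat.log 2 k + 2 + 1) ^ 3 * S : ℕ) : ℝ) := by
            rw [ENNReal.ofReal_natCast, ENat.toENNReal_coe]
        _ ≤ ENNReal.ofReal (5000000 * S * Real.log k ^ 3) := ENNReal.ofReal_le_ofReal h₇
        _ = _ := by
            rw [ENNReal.ofReal_mul (by positivity), ENNReal.ofReal_mul (by norm_num),
              ENNReal.ofReal_natCast, ENat.toENNReal_coe]
            congr 2
            exact ENNReal.ofReal_natCast 5000000
  · have hsum : ∑ i, GardenHose.GH (f i) = ⊤ := by
      obtain ⟨i, hi⟩ := not_forall.1 htop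
      exact WithTop.sum_eq_top.2 ⟨i, Finset.mem_univ i, not_not.1 hi⟩
    have hmul : ((5000000 : ℕ) : ℕ∞) * ⊤ = ⊤ := ENat.mul_top (by norm_num)
    rw [hsum, hmul]
    refine ⟨fun _ => ⟨le_top, le_top, le_top⟩, fun hk => ?_⟩
    -- Since `⊤ * 0 = 0`, the bound is infinite only because `Real.log k` is positive.
    rw [ENat.toENNReal_top, ENNReal.mul_top (by norm_num), ENNReal.top_mul]
    · exact le_top
    · exact (ENNReal.ofReal_pos.2 (pow_pos (hlog k hk) 3)).ne'
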